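/- Let $n,m,r\in\mathbb{N}$ and $T>0$. Let $B\in\mathbb{R}^{n\times m}$, $C\in\mathbb{R}^{r\times n}$, $x_0\in\mathbb{R}^n$ and $y\in L^2(0,T;\mathbb{R}^r)$. Consider two data tuples $$\mathcal{S}_*=(A_*,\Gamma_*,R_*,Q_*),\qquad \mathcal{S}_{\bar\sigma}=(A_{\bar\sigma},\Gamma_{\bar\sigma},R_{\bar\sigma},Q_{\bar\sigma})\qquad\text{in } \mathbb{R}^{n\times n}\times\mathbb{R}^{n\times n}\times\mathbb{R}^{m\times m}\times\mathbb{R}^{r\times r},$$ where the matrices $\Gamma,R,Q$ of both tuples are symmetric positive definite. For $\sigma\in\{*,\bar\sigma\}$ let $\Pi_\sigma\in C([0,T];\mathbb{R}^{n\times n})$ be the solution of the differential Riccati equation $$\dot\Pi_\sigma(t)=A_\sigma\Pi_\sigma(t)+\Pi_\sigma(t)A_\sigma^\top-\Pi_\sigma(t)C^\top Q_\sigma^{-1}C\,\Pi_\sigma(t)+BR_\sigma B^\top,\quad t\in(0,T),\qquad \Pi_\sigma(0)=\Gamma_\sigma,$$ and let $\widehat{x}_\sigma$ be the associated Kalman filter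 trajectory, i.e. the absolutely continuous solution of $$\dot{\widehat{x}}_\sigma(t)=A_\sigma\widehat{x}_\sigma(t)+\Pi_\sigma(t)C^\top Q_\sigma^{-1}\bigl(y(t)-C\widehat{x}_\sigma(t)\bigr)\quad\text{for a.e. } t\in(0,T),\qquad \widehat{x}_\sigma(0)=x_0.$$ Then there is a constant $c>0$, independent of $t$, such that for all $t\in[0,T]$ $$\|\widehat{x}_*(t)-\widehat{x}_{\bar\sigma}(t)\|\le c\,\|\mathcal{S}_*-\mathcal{S}_{\bar\sigma}\|_1,$$ where $\|\cdot\|$ is the Euclidean norm of vectors and the spectral norm of matrices, differences of tuples are taken componentwise, and $\|(A,\Gamma,R,Q)\|_1=\|A\|+\|\Gamma\|+\|R\|+\|Q\|$. The constant can be chosen uniformly for bounded data: for given $n,m,r,T$ and every $M\in\mathbb{R}$ there is one $c>0$ with which the estimate holds for all $B,C,x_0,y,\mathcal{S}_*,\mathcal{S}_{\bar\sigma}$ as above such that $\|B\|$, $\|C\|$, $\|x_0\|$, $\|y\|_{L^2(0,T;\mathbb{R}^r)}$ and, for both tuples, $\|A_\sigma\|$, $\|\Gamma_\sigma\|$, $\|R_\sigma\|$,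 $\|Q_\sigma^{-1}\|$ are at most $M$. -/

import Mathlib

open MeasureTheory Set
open scoped Matrix ENNReal Matrix.Norms.L2Operator

/-- A data tuple `𝒮 = (A, Γ, R, Q)`: system matrix, covariance of the initial state, covariance of
the model disturbance and covariance of the measurement disturbance. -/
@[ext]
structure SystemData (n m r : ℕ) where
  A : Matrix (Fin n) (Fin n) ℝ
  Γ : Matrix (Fin n) (Fin n) ℝ
  R : Matrix (Fin m) (Fin m) ℝ
  Q : Matrix (Fin r) (Fin r) ℝ

namespace SystemData

variable {n m r : ℕ}

/-- Differences of data tuples are understood componentwise. -/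
instance : Sub (SystemData n m r) where
  sub S S' := ⟨S.A - S'.A, S.Γ - S'.Γ, S.R - S'.R, S.Q - S'.Q⟩

/-- `‖𝒮‖₁ = ‖A‖ + ‖Γ‖ + ‖R‖ + ‖Q‖`, with the spectral norm of matrices. -/
noncomputable def norm₁ (S : SystemData n m r) : ℝ :=
  ‖S.A‖ + ‖S.Γ‖ + ‖S.R‖ + ‖S.Q‖

/-- The three covariance matrices are symmetric and positive definite. -/
structure IsAdmissible (S : SystemData n m r) : Prop where
  posDef_Γ : S.Γ.PosDef
  posDef_R : S.R.PosDef
  posDef_Q : S.Q.PosDef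

/-- The norms of `A`, `Γ`, `R` and `Q⁻¹` are at most `M`. -/
structure BoundedBy (S : SystemData n m r) (M : ℝ) : Prop where
  norm_A_le : ‖S.A‖ ≤ M
  norm_Γ_le : ‖S.Γ‖ ≤ M
  norm_R_le : ‖S.R‖ ≤ M
  norm_Q_inv_le : ‖S.Q⁻¹‖ ≤ M

/-- `Π` is a (classical) solution on `[0, T]` of the differential Riccati equation
`Π' = A Π + Π Aᵀ - Π Cᵀ Q⁻¹ C Π + B R Bᵀ`, `Π(0) = Γ`. -/
structure IsRiccatiSolution (S : SystemData n m r)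
    (B : Matrix (Fin n) (Fin m) ℝ) (C : Matrix (Fin r) (Fin n) ℝ) (T : ℝ)
    (P : ℝ → Matrix (Fin n) (Fin n) ℝ) : Prop where
  continuousOn : ContinuousOn P (Icc 0 T)
  initial : P 0 = S.Γ
  hasDerivAt : ∀ t ∈ Ioo 0 T,
    HasDerivAt P
      (S.A * P t + P t * S.Aᵀ - P t * Cᵀ * S.Q⁻¹ * C * P t + B * S.R * Bᵀ) t

/-- `x` is the Kalman filter trajectory on `[0, T]` with covariance `Π`, i.e. a solution of
`x' = A x + Π Cᵀ Q⁻¹ (y - C x)`, `x(0) = x₀`. As `y` is only an `L²` function, `x` is absolutely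
continuous and the equation holds almost everywhere. -/
structure IsFilterSolution (S : SystemData n m r)
    (C : Matrix (Fin r) (Fin n) ℝ) (T : ℝ) (x₀ : EuclideanSpace ℝ (Fin n))
    (y : ℝ → EuclideanSpace ℝ (Fin r)) (P : ℝ → Matrix (Fin n) (Fin n) ℝ)
    (x : ℝ → EuclideanSpace ℝ (Fin n)) : Prop where
  absolutelyContinuous : AbsolutelyContinuousOnInterval x 0 T
  initial : x 0 = x₀
  hasDerivAt : ∀ᵐ t ∂(volume.restrict (Ioo 0 T)),
    HasDerivAt x
      (S.A.toEuclideanLin (x t)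
        + (P t * Cᵀ * S.Q⁻¹).toEuclideanLin (y t - C.toEuclideanLin (x t))) t

end SystemData

/-! The difference of two Riccati solutions satisfies a differential inequality that is linear in
that difference, once both solutions are bounded, with a forcing term linear in the data
differences. Grönwall then gives `Matrix.norm_riccati_sub_le`. The filter gains inherit this
Lipschitz estimate, and a second Grönwall argument, for absolutely continuous curves with integrable
forcing since `y` is only square integrable, transfers it to the trajectories.

For a uniform constant, the bound on the covariances must depend on `M` and `T` alone although the
equation is quadratic. This is `Matrix.norm_riccati_le`: scalar multiples of the identity serve as
strict barriers above and below, and `Matrix.PosDef.of_hasDerivAt` shows that they are never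
touched. At a first contact the touching vector is an eigenvector of the solution, so the matrix
equation reduces to scalars; above, the quadratic term has the good sign, and below, the barrier is
at most one in size, so the term is harmless. Only the inverse of `Q` has to be bounded, because
inversion is Lipschitz where the inverses are bounded. -/

/-! ### Grönwall's inequality for absolutely continuous curves -/

open Filter Topology in
/-- The derivative of the norm of a curve is bounded by the norm of its derivative. -/
theorem HasDerivAt.abs_deriv_norm_le {E : Type*} [NormedAddCommGroup E] [NormedSpace ℝ E]
    {f : ℝ → E} {f' : E} {u' t : ℝ} (hf : HasDerivAt f f' t)
    (hu : HasDerivAt (fun s => ‖f s‖) u' t) : |u'| ≤ ‖f'‖ := by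
  have h₁ := (hasDerivAt_iff_tendsto_slope.1 hf).norm
  have h₂ := (hasDerivAt_iff_tendsto_slope.1 hu).norm
  refine le_of_tendsto_of_tendsto' h₂ h₁ fun s => ?_
  simp only [slope_def_module, norm_smul, smul_eq_mul, norm_mul]
  gcongr
  exact abs_norm_sub_norm_le _ _

/-- The norm of an absolutely continuous curve is absolutely continuous. -/
theorem AbsolutelyContinuousOnInterval.norm_comp {E : Type*} [NormedAddCommGroup E]
    {f : ℝ → E} {a b : ℝ} (hf : AbsolutelyContinuousOnInterval f a b) :
    AbsolutelyContinuousOnInterval (fun t => ‖f t‖) a b := by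
  rw [absolutelyContinuousOnInterval_iff] at hf ⊢
  intro ε hε
  obtain ⟨δ, hδ, h⟩ := hf ε hε
  refine ⟨δ, hδ, fun I hI hlen => lt_of_le_of_lt (Finset.sum_le_sum fun i _ => ?_) (h I hI hlen)⟩
  rw [dist_eq_norm (f _)]
  exact dist_norm_norm_le _ _

/-- A Grönwall inequality for absolutely continuous curves with integrable forcing. -/
theorem AbsolutelyContinuousOnInterval.norm_le_exp_mul {E : Type*} [NormedAddCommGroup E]
    [NormedSpace ℝ E] {f f' : ℝ → E} {b : ℝ → ℝ} {K T : ℝ} (hK : 0 ≤ K)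
    (hf : AbsolutelyContinuousOnInterval f 0 T)
    (hf' : ∀ᵐ t ∂(volume.restrict (Ioo 0 T)), HasDerivAt f (f' t) t)
    (hb : IntegrableOn b (Ioo 0 T)) (hb₀ : ∀ t, 0 ≤ b t)
    (hbound : ∀ᵐ t ∂(volume.restrict (Ioo 0 T)), ‖f' t‖ ≤ K * ‖f t‖ + b t)
    {t : ℝ} (ht : t ∈ Icc 0 T) :
    ‖f t‖ ≤ Real.exp (K * T) * (‖f 0‖ + ∫ s in Ioo 0 T, b s) := by
  have hT : 0 ≤ T := ht.1.trans ht.2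
  set w : ℝ → ℝ := fun s => Real.exp (-K * s) * ‖f s‖ with hw
  have hexp : AbsolutelyContinuousOnInterval (fun s => Real.exp (-K * s)) 0 T :=
    ContDiffOn.absolutelyContinuousOnInterval (by fun_prop)
  have hwT : AbsolutelyContinuousOnInterval w 0 T := hexp.fun_mul hf.norm_comp
  have hwt : AbsolutelyContinuousOnInterval w 0 t := hwT.mono (by
    rw [uIcc_of_le ht.1, uIcc_of_le hT]; exact Icc_subset_Icc_right ht.2)
  -- The integrating factor cancels the term `K * ‖f s‖`; being at most one, it can then be dropped
  -- from the forcing.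
  have hae : ∀ᵐ s ∂(volume.restrict (Ioo 0 T)), deriv w s ≤ b s := by
    have hdiff := hf.norm_comp.ae_differentiableAt
    rw [ae_restrict_iff' measurableSet_Ioo] at hf' hbound ⊢
    filter_upwards [hf', hbound, hdiff] with s h₁ h₂ h₃ hs
    have hu := (h₃ (by rw [uIcc_of_le hT]; exact Ioo_subset_Icc_self hs)).hasDerivAt
    have hd := (h₁ hs).abs_deriv_norm_le hu
    have he : HasDerivAt (fun s => Real.exp (-K * s)) (Real.exp (-K * s) * (-K)) s := by
      simpa using ((hasDerivAt_id s).const_mul (-K)).exp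
    rw [(he.fun_mul hu : HasDerivAt w _ s).deriv]
    have hle : deriv (fun s => ‖f s‖) s - K * ‖f s‖ ≤ b s := by
      linarith [le_abs_self (deriv (fun s => ‖f s‖) s), h₂ hs]
    have he₁ : Real.exp (-K * s) ≤ 1 := Real.exp_le_one_iff.2 (by nlinarith [hs.1])
    calc _ = Real.exp (-K * s) * (deriv (fun s => ‖f s‖) s - K * ‖f s‖) := by ring
      _ ≤ Real.exp (-K * s) * b s := by gcongr
      _ ≤ b s := mul_le_of_le_one_left (hb₀ s) he₁
  have hint := hwt.integral_deriv_eq_sub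
  have hle : ∫ s in (0 : ℝ)..t, deriv w s ≤ ∫ s in Ioo 0 T, b s := by
    rw [intervalIntegral.integral_of_le ht.1, integral_Ioc_eq_integral_Ioo]
    have hsub : Ioo 0 t ⊆ Ioo 0 T := Ioo_subset_Ioo_right ht.2
    calc _ ≤ ∫ s in Ioo 0 t, b s := by
          refine integral_mono_ae ?_ (hb.mono_set hsub) (ae_restrict_of_ae_restrict_of_subset hsub hae)
          exact ((intervalIntegrable_iff_integrableOn_Ioo_of_le ht.1).1 hwt.intervalIntegrable_deriv)
      _ ≤ _ := setIntegral_mono_set hb (ae_of_all _ hb₀) hsub.eventuallyLE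
  have hwle : w t ≤ ‖f 0‖ + ∫ s in Ioo 0 T, b s := by
    have : w 0 = ‖f 0‖ := by simp [hw]
    linarith
  have hft : ‖f t‖ = Real.exp (K * t) * w t := by
    rw [hw, ← mul_assoc, ← Real.exp_add]; simp
  have hI : 0 ≤ ∫ s in Ioo 0 T, b s := integral_nonneg hb₀
  rw [hft]
  gcongr
  exact ht.2

/-- A curve continuous on `[0, T]` with bounded derivative on `(0, T)` is absolutely continuous. -/
theorem absolutelyContinuousOnInterval_of_hasDerivAt_of_norm_le {E : Type*} [NormedAddCommGroup E]
    [NormedSpace ℝ E] {f f' : ℝ → E} {L T : ℝ} (hT : 0 < T)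
    (hf : ContinuousOn f (Icc 0 T)) (hf' : ∀ t ∈ Ioo 0 T, HasDerivAt f (f' t) t)
    (hL : ∀ t ∈ Ioo 0 T, ‖f' t‖ ≤ L) : AbsolutelyContinuousOnInterval f 0 T := by
  have h := (convex_Ioo 0 T).lipschitzOnWith_of_nnnorm_hasDerivWithin_le (C := L.toNNReal)
    (fun t ht => (hf' t ht).hasDerivWithinAt)
    (fun t ht => by
      rw [← NNReal.coe_le_coe, coe_nnnorm]
      exact (hL t ht).trans (Real.le_coe_toNNReal L))
  have hcl : closure (Ioo 0 T) = Icc 0 T := closure_Ioo hT.ne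
  refine LipschitzOnWith.absolutelyContinuousOnInterval (K := L.toNNReal) ?_
  rw [uIcc_of_le hT.le, ← hcl]
  exact h.closure (hcl ▸ hf)

/-! ### Spectral norms, quadratic forms and a first-contact principle -/

namespace Matrix

variable {n : ℕ}

/-- The quadratic form of a matrix is bounded by its spectral norm. -/
theorem abs_dotProduct_mulVec_le (A : Matrix (Fin n) (Fin n) ℝ) (v : Fin n → ℝ) :
    |v ⬝ᵥ A *ᵥ v| ≤ ‖A‖ * (v ⬝ᵥ v) := by
  set x : EuclideanSpace ℝ (Fin n) := WithLp.toLp 2 v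
  have hin : inner ℝ x (WithLp.toLp 2 (A *ᵥ v)) = v ⬝ᵥ A *ᵥ v := by
    simp [x, EuclideanSpace.inner_eq_star_dotProduct, dotProduct_comm]
  have hxx : ‖x‖ * ‖x‖ = v ⬝ᵥ v := by
    rw [← real_inner_self_eq_norm_mul_norm, EuclideanSpace.inner_eq_star_dotProduct, star_trivial]
  rw [← hin, ← hxx]
  calc _ ≤ ‖x‖ * ‖WithLp.toLp 2 (A *ᵥ v)‖ := abs_real_inner_le_norm _ _
    _ ≤ ‖x‖ * (‖A‖ * ‖x‖) := by gcongr; exact l2_opNorm_mulVec A x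
    _ = _ := by ring

/-- A symmetric matrix whose quadratic form is bounded by `b` has spectral norm at most `b`. -/
theorem IsHermitian.norm_le_of_abs_dotProduct_mulVec_le {A : Matrix (Fin n) (Fin n) ℝ}
    (hA : A.IsHermitian) {b : ℝ} (hb : 0 ≤ b)
    (h : ∀ v : Fin n → ℝ, |v ⬝ᵥ A *ᵥ v| ≤ b * (v ⬝ᵥ v)) : ‖A‖ ≤ b := by
  rw [cstar_norm_def]
  set L := toEuclideanCLM (n := Fin n) (𝕜 := ℝ) A
  have hq : ∀ x, |inner ℝ x (L x)| ≤ b * ‖x‖ ^ 2 := by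
    intro x
    have := h x.ofLp
    rw [← real_inner_self_eq_norm_sq]
    convert this using 2
    · simp [L, inner_toEuclideanCLM]
    · rw [EuclideanSpace.inner_eq_star_dotProduct, star_trivial]
  have hsymm : ∀ x y, inner ℝ (L x) y = inner ℝ x (L y) :=
    fun x y => isSymmetric_toEuclideanLin_iff.2 hA x y
  refine ContinuousLinearMap.opNorm_le_bound _ hb fun x => ?_
  rcases eq_or_ne (L x) 0 with h0 | h0
  · rw [h0, norm_zero]; positivity
  have hx : 0 < ‖x‖ := norm_pos_iff.2 fun hx => h0 (by rw [hx, map_zero])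
  have hLx : 0 < ‖L x‖ := norm_pos_iff.2 h0
  -- With `L x` rescaled to the length of `x`, polarisation gives `4 * (‖x‖ * ‖L x‖)` and the
  -- parallelogram law bounds it by `4 * b * ‖x‖ ^ 2`.
  set y := (‖x‖ / ‖L x‖) • L x with hy
  have hny : ‖y‖ = ‖x‖ := by
    rw [hy, norm_smul, Real.norm_of_nonneg (by positivity)]; field_simp
  have hxy : inner ℝ (L x) y = ‖x‖ * ‖L x‖ := by
    rw [hy, inner_smul_right, real_inner_self_eq_norm_sq]; field_simp
  have hpol : inner ℝ (x + y) (L (x + y)) - inner ℝ (x - y) (L (x - y)) = 4 * (‖x‖ * ‖L x‖) := by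
    have h₁ : inner ℝ x (L y) = ‖x‖ * ‖L x‖ := by rw [← hsymm, hxy]
    have h₂ : inner ℝ y (L x) = ‖x‖ * ‖L x‖ := by rw [real_inner_comm, hxy]
    simp only [map_add, map_sub, inner_add_left, inner_add_right, inner_sub_left, inner_sub_right,
      h₁, h₂]
    ring
  have hpar := parallelogram_law_with_norm ℝ x y
  have h₁ := (abs_le.1 (hq (x + y))).2
  have h₂ := (abs_le.1 (hq (x - y))).1
  have : 4 * (‖x‖ * ‖L x‖) ≤ 4 * (‖x‖ * (b * ‖x‖)) := by
    rw [hny] at hpar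
    nlinarith
  exact le_of_mul_le_mul_left (by linarith) hx

/-- The spectral norm is invariant under transposition. -/
theorem l2_opNorm_transpose {m : ℕ} (A : Matrix (Fin m) (Fin n) ℝ) : ‖Aᵀ‖ = ‖A‖ := by
  rw [← conjTranspose_eq_transpose_of_trivial, l2_opNorm_conjTranspose]

/-- Evaluating the quadratic form at a fixed vector preserves derivatives. -/
theorem _root_.HasDerivAt.dotProduct_mulVec {W : ℝ → Matrix (Fin n) (Fin n) ℝ}
    {W' : Matrix (Fin n) (Fin n) ℝ} {t : ℝ} (hW : HasDerivAt W W' t) (v : Fin n → ℝ) :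
    HasDerivAt (fun s => v ⬝ᵥ W s *ᵥ v) (v ⬝ᵥ W' *ᵥ v) t := by
  let φ : Matrix (Fin n) (Fin n) ℝ →ₗ[ℝ] ℝ :=
    { toFun := fun A => v ⬝ᵥ A *ᵥ v
      map_add' := fun A B => by rw [add_mulVec, dotProduct_add]
      map_smul' := fun c A => by rw [smul_mulVec, dotProduct_smul, RingHom.id_apply] }
  exact (LinearMap.toContinuousLinearMap φ).hasFDerivAt.comp_hasDerivAt t hW

open Filter Topology in
/-- A differentiable curve of symmetric matrices that starts positive definite stays positive
definite as long as its derivative is positive on the kernel. -/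
theorem PosDef.of_hasDerivAt {W W' : ℝ → Matrix (Fin n) (Fin n) ℝ} {T : ℝ}
    (hcont : ContinuousOn W (Icc 0 T)) (hsymm : ∀ t ∈ Icc 0 T, (W t).IsHermitian)
    (h0 : (W 0).PosDef) (hW' : ∀ t ∈ Ioo 0 T, HasDerivAt W (W' t) t)
    (hker : ∀ t ∈ Ioo 0 T, ∀ v : Fin n → ℝ, v ≠ 0 → W t *ᵥ v = 0 → 0 < v ⬝ᵥ W' t *ᵥ v)
    {t : ℝ} (ht : t ∈ Ico 0 T) : (W t).PosDef := by
  have htT : Icc 0 t ⊆ Icc 0 T := Icc_subset_Icc_right ht.2.le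
  refine .of_dotProduct_mulVec_pos (hsymm t ⟨ht.1, ht.2.le⟩) fun v₀ hv₀ => ?_
  by_contra hneg
  rw [star_trivial, not_lt] at hneg
  let q : ℝ × (Fin n → ℝ) → ℝ := fun p => p.2 ⬝ᵥ W p.1 *ᵥ p.2
  have hq : ContinuousOn q (Icc 0 t ×ˢ Metric.sphere 0 1) := by
    have hW : ContinuousOn (fun p : ℝ × (Fin n → ℝ) => W p.1) (Icc 0 t ×ˢ Metric.sphere 0 1) :=
      (hcont.mono htT).comp continuousOn_fst fun p hp => hp.1
    rw [continuousOn_iff_continuous_domRestrict] at hW ⊢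
    exact (continuous_snd.comp continuous_subtype_val).dotProduct
      (hW.matrix_mulVec (continuous_snd.comp continuous_subtype_val))
  -- Normalising the vectors makes the set of contacts compact, so its projection to time has a
  -- least element: the first contact time.
  have hcomp : IsCompact ((Icc 0 t ×ˢ Metric.sphere (0 : Fin n → ℝ) 1) ∩ q ⁻¹' Iic 0) :=
    (isCompact_Icc.prod (isCompact_sphere 0 1)).of_isClosed_subset
      (hq.preimage_isClosed_of_isClosed (isClosed_Icc.prod Metric.isClosed_sphere) isClosed_Iic)
      inter_subset_left
  have hscale : ∀ s, ∀ v : Fin n → ℝ, v ≠ 0 → v ⬝ᵥ W s *ᵥ v ≤ 0 →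
      (‖v‖⁻¹ • v) ∈ Metric.sphere (0 : Fin n → ℝ) 1 ∧ q (s, ‖v‖⁻¹ • v) ≤ 0 := by
    intro s v hv hvs
    refine ⟨by simp [norm_smul, norm_ne_zero_iff.2 hv], ?_⟩
    simp only [q, mulVec_smul, dotProduct_smul, smul_dotProduct, smul_eq_mul]
    exact mul_nonpos_of_nonneg_of_nonpos (by positivity)
      (mul_nonpos_of_nonneg_of_nonpos (by positivity) hvs)
  have hne : (Prod.fst '' ((Icc 0 t ×ˢ Metric.sphere (0 : Fin n → ℝ) 1) ∩ q ⁻¹' Iic 0)).Nonempty :=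
    ⟨t, _, ⟨⟨⟨ht.1, le_rfl⟩, (hscale t v₀ hv₀ hneg).1⟩, (hscale t v₀ hv₀ hneg).2⟩, rfl⟩
  obtain ⟨τ, ⟨⟨τ', v⟩, ⟨⟨hτ, hv⟩, hqv⟩, rfl⟩, hmin⟩ := (hcomp.image continuous_fst).exists_isLeast hne
  simp only [mem_preimage, mem_Iic, q] at hqv hτ hv hmin
  have hv0 : v ≠ 0 := ne_zero_of_mem_unit_sphere ⟨v, hv⟩
  have hτ0 : 0 < τ' := by
    refine lt_of_le_of_ne hτ.1 fun h => ?_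
    subst h
    exact absurd (h0.dotProduct_mulVec_pos hv0) (by simpa using hqv)
  -- Here `t < T` matters: the derivative is available at interior times only.
  have hτI : τ' ∈ Ioo 0 T := ⟨hτ0, hτ.2.trans_lt ht.2⟩
  have hpos : ∀ s ∈ Ico 0 τ', ∀ w : Fin n → ℝ, w ≠ 0 → 0 < w ⬝ᵥ W s *ᵥ w := by
    intro s hs w hw
    by_contra hws
    rw [not_lt] at hws
    exact absurd (hmin ⟨_, ⟨⟨⟨hs.1, hs.2.le.trans hτ.2⟩, (hscale s w hw hws).1⟩,
      (hscale s w hw hws).2⟩, rfl⟩) (not_le.2 hs.2)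
  have hleft : ∀ᶠ s in 𝓝[<] τ', s ∈ Ico 0 τ' := by
    filter_upwards [Ioo_mem_nhdsLT hτ0] with s hs using ⟨hs.1.le, hs.2⟩
  have hpsd : (W τ').PosSemidef := by
    refine .of_dotProduct_mulVec_nonneg (hsymm τ' (Ioo_subset_Icc_self hτI)) fun w => ?_
    rw [star_trivial]
    rcases eq_or_ne w 0 with rfl | hw
    · simp
    refine ge_of_tendsto (((hW' τ' hτI).dotProduct_mulVec w).continuousAt.tendsto.mono_left
      (nhdsWithin_le_nhds (s := Iio τ'))) ?_
    filter_upwards [hleft] with s hs using (hpos s hs w hw).le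
  have hqv0 : v ⬝ᵥ W τ' *ᵥ v = 0 :=
    le_antisymm hqv (by simpa using hpsd.dotProduct_mulVec_nonneg v)
  have hWv : W τ' *ᵥ v = 0 := (hpsd.dotProduct_mulVec_zero_iff v).1 (by simpa using hqv0)
  -- The form at `v` is positive before `τ'` and zero at `τ'`, so its left difference quotients are
  -- nonpositive, against `hker`.
  have hd := (hasDerivAt_iff_tendsto_slope.1 ((hW' τ' hτI).dotProduct_mulVec v)).mono_left
    (nhdsWithin_mono τ' (show Iio τ' ⊆ {τ'}ᶜ from fun s hs => ne_of_lt hs))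
  refine absurd (hker τ' hτI v hv0 hWv) (not_lt.2 (le_of_tendsto hd ?_))
  filter_upwards [hleft] with s hs
  rw [slope_def_field, hqv0, sub_zero]
  exact div_nonpos_of_nonneg_of_nonpos (hpos s hs v hv0).le (by linarith [hs.2])

/-! ### The differential Riccati equation: stability, symmetry, a priori bound -/

/-- Stability of the differential Riccati equation with respect to its coefficients. -/
theorem norm_riccati_sub_le {A₁ A₂ G₁ G₂ H₁ H₂ : Matrix (Fin n) (Fin n) ℝ}
    {P₁ P₂ : ℝ → Matrix (Fin n) (Fin n) ℝ} {T a g p : ℝ} (hT : 0 < T)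
    (hP₁ : ContinuousOn P₁ (Icc 0 T)) (hP₂ : ContinuousOn P₂ (Icc 0 T))
    (hd₁ : ∀ t ∈ Ioo 0 T, HasDerivAt P₁ (A₁ * P₁ t + P₁ t * A₁ᵀ - P₁ t * G₁ * P₁ t + H₁) t)
    (hd₂ : ∀ t ∈ Ioo 0 T, HasDerivAt P₂ (A₂ * P₂ t + P₂ t * A₂ᵀ - P₂ t * G₂ * P₂ t + H₂) t)
    (ha : ‖A₂‖ ≤ a) (hg₁ : ‖G₁‖ ≤ g) (hg₂ : ‖G₂‖ ≤ g)
    (hp₁ : ∀ t ∈ Ioo 0 T, ‖P₁ t‖ ≤ p) (hp₂ : ∀ t ∈ Ioo 0 T, ‖P₂ t‖ ≤ p)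
    {t : ℝ} (ht : t ∈ Icc 0 T) :
    ‖P₁ t - P₂ t‖ ≤ Real.exp ((2 * a + 2 * (p * g)) * T) *
      (‖P₁ 0 - P₂ 0‖ + T * (2 * (‖A₁ - A₂‖ * p) + p * ‖G₁ - G₂‖ * p + ‖H₁ - H₂‖)) := by
  have ha0 : 0 ≤ a := (norm_nonneg _).trans ha
  have hg0 : 0 ≤ g := (norm_nonneg _).trans hg₁
  have hp0 : 0 ≤ p := (norm_nonneg _).trans (hp₁ (T / 2) ⟨by linarith, by linarith⟩)
  set β := 2 * (‖A₁ - A₂‖ * p) + p * ‖G₁ - G₂‖ * p + ‖H₁ - H₂‖ with hβ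
  have hβ0 : 0 ≤ β := by positivity
  set D' : ℝ → Matrix (Fin n) (Fin n) ℝ := fun t =>
    (A₁ * P₁ t + P₁ t * A₁ᵀ - P₁ t * G₁ * P₁ t + H₁)
      - (A₂ * P₂ t + P₂ t * A₂ᵀ - P₂ t * G₂ * P₂ t + H₂) with hD'
  have hder : ∀ t ∈ Ioo 0 T, HasDerivAt (fun s => P₁ s - P₂ s) (D' t) t :=
    fun t ht => (hd₁ t ht).sub (hd₂ t ht)
  have hbound : ∀ t ∈ Ioo 0 T, ‖D' t‖ ≤ (2 * a + 2 * (p * g)) * ‖P₁ t - P₂ t‖ + β := by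
    intro t ht
    have h₁ := hp₁ t ht
    have h₂ := hp₂ t ht
    -- Telescoping leaves exactly one difference in each term. Symmetry of the solutions is not
    -- used, so the estimate can serve to prove it.
    have hsplit : D' t = ((A₁ - A₂) * P₁ t + A₂ * (P₁ t - P₂ t))
        + (P₁ t * (A₁ - A₂)ᵀ + (P₁ t - P₂ t) * A₂ᵀ)
        - ((P₁ t - P₂ t) * G₁ * P₁ t + P₂ t * (G₁ - G₂) * P₁ t + P₂ t * G₂ * (P₁ t - P₂ t))
        + (H₁ - H₂) := by
      simp only [hD', transpose_sub]; noncomm_ring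
    set Δ := ‖P₁ t - P₂ t‖ with hΔ
    have e₁ : ‖(A₁ - A₂) * P₁ t + A₂ * (P₁ t - P₂ t)‖ ≤ ‖A₁ - A₂‖ * p + a * Δ :=
      norm_add_le_of_le (norm_mul_le_of_le le_rfl h₁) (norm_mul_le_of_le ha le_rfl)
    have e₂ : ‖P₁ t * (A₁ - A₂)ᵀ + (P₁ t - P₂ t) * A₂ᵀ‖ ≤ p * ‖A₁ - A₂‖ + Δ * a :=
      norm_add_le_of_le (norm_mul_le_of_le h₁ (l2_opNorm_transpose _).le)
        (norm_mul_le_of_le le_rfl ((l2_opNorm_transpose _).trans_le ha))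
    have e₃ : ‖(P₁ t - P₂ t) * G₁ * P₁ t + P₂ t * (G₁ - G₂) * P₁ t + P₂ t * G₂ * (P₁ t - P₂ t)‖
        ≤ Δ * g * p + p * ‖G₁ - G₂‖ * p + p * g * Δ :=
      norm_add₃_le.trans (add_le_add (add_le_add
        (norm_mul_le_of_le (norm_mul_le_of_le le_rfl hg₁) h₁)
        (norm_mul_le_of_le (norm_mul_le_of_le h₂ le_rfl) h₁))
        (norm_mul_le_of_le (norm_mul_le_of_le h₂ hg₂) le_rfl))
    rw [hsplit]
    refine (norm_add_le_of_le (norm_sub_le_of_le (norm_add_le_of_le e₁ e₂) e₃) le_rfl).trans_eq ?_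
    rw [hβ]; ring
  have hK : 0 ≤ 2 * a + 2 * (p * g) := by positivity
  have hac := absolutelyContinuousOnInterval_of_hasDerivAt_of_norm_le
    (L := (2 * a + 2 * (p * g)) * (p + p) + β) hT (hP₁.sub hP₂) hder
    (fun t ht => (hbound t ht).trans (by
      gcongr; exact norm_sub_le_of_le (hp₁ t ht) (hp₂ t ht)))
  have hgr := hac.norm_le_exp_mul hK (b := fun _ => β)
    ((ae_restrict_iff' measurableSet_Ioo).2 (ae_of_all _ hder))
    (integrableOn_const (by simp)) (fun _ => hβ0)
    ((ae_restrict_iff' measurableSet_Ioo).2 (ae_of_all _ hbound)) ht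
  simpa [hT.le] using hgr

/-- Solutions of the differential Riccati equation with symmetric data are symmetric. -/
theorem isHermitian_of_riccati {A G H : Matrix (Fin n) (Fin n) ℝ}
    {P : ℝ → Matrix (Fin n) (Fin n) ℝ} {T : ℝ} (hT : 0 < T)
    (hP : ContinuousOn P (Icc 0 T))
    (hd : ∀ t ∈ Ioo 0 T, HasDerivAt P (A * P t + P t * Aᵀ - P t * G * P t + H) t)
    (hG : G.IsHermitian) (hH : H.IsHermitian) (h0 : (P 0).IsHermitian)
    {t : ℝ} (ht : t ∈ Icc 0 T) : (P t).IsHermitian := by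
  -- Any bound suffices, as only uniqueness is needed: the transpose solves the same initial value
  -- problem. The uniform bound itself relies on symmetry.
  obtain ⟨p, hp⟩ := isCompact_Icc.exists_bound_of_continuousOn hP
  have htr : Continuous (fun A : Matrix (Fin n) (Fin n) ℝ => Aᵀ) := continuous_id.matrix_transpose
  rw [IsHermitian, conjTranspose_eq_transpose_of_trivial] at hG hH h0 ⊢
  have hd' : ∀ t ∈ Ioo 0 T, HasDerivAt (fun s => (P s)ᵀ)
      (A * (P t)ᵀ + (P t)ᵀ * Aᵀ - (P t)ᵀ * G * (P t)ᵀ + H) t := by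
    intro t ht
    have := (LinearMap.toContinuousLinearMap
      (transposeLinearEquiv (Fin n) (Fin n) ℝ ℝ).toLinearMap).hasFDerivAt.comp_hasDerivAt t (hd t ht)
    refine this.congr_deriv ?_
    simp [transpose_mul, hG, hH, mul_assoc, add_comm]
  have := norm_riccati_sub_le hT hP (htr.comp_continuousOn hP) hd hd' le_rfl le_rfl le_rfl
    (fun t ht => hp t (Ioo_subset_Icc_self ht))
    (fun t ht => (l2_opNorm_transpose _).trans_le (hp t (Ioo_subset_Icc_self ht))) ht
  simp only [Function.comp_def, h0, sub_self, norm_zero, mul_zero, zero_mul, add_zero] at this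
  exact (sub_eq_zero.1 (norm_le_zero_iff.1 this)).symm

/-- The derivative of the quadratic form along a Riccati solution, at an eigenvector. -/
theorem dotProduct_riccati_mulVec {A G H P : Matrix (Fin n) (Fin n) ℝ} (hP : P.IsHermitian)
    {v : Fin n → ℝ} {l : ℝ} (hv : P *ᵥ v = l • v) :
    v ⬝ᵥ (A * P + P * Aᵀ - P * G * P + H) *ᵥ v
      = 2 * l * (v ⬝ᵥ A *ᵥ v) - l ^ 2 * (v ⬝ᵥ G *ᵥ v) + v ⬝ᵥ H *ᵥ v := by
  have hv' : v ᵥ* P = l • v := by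
    rw [← mulVec_transpose, ← conjTranspose_eq_transpose_of_trivial, hP.eq, hv]
  have hA : v ⬝ᵥ Aᵀ *ᵥ v = v ⬝ᵥ A *ᵥ v := by
    rw [mulVec_transpose, dotProduct_comm, ← dotProduct_mulVec]
  simp only [add_mulVec, sub_mulVec, dotProduct_add, dotProduct_sub, ← mulVec_mulVec, hv,
    mulVec_smul, dotProduct_smul]
  simp only [dotProduct_mulVec v P, hv', smul_dotProduct, hA, smul_eq_mul]
  ring

/-- A priori bound for solutions of the differential Riccati equation. -/
theorem norm_riccati_le {A G H : Matrix (Fin n) (Fin n) ℝ}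
    {P : ℝ → Matrix (Fin n) (Fin n) ℝ} {T a g h γ : ℝ} (hT : 0 < T)
    (hP : ContinuousOn P (Icc 0 T))
    (hd : ∀ t ∈ Ioo 0 T, HasDerivAt P (A * P t + P t * Aᵀ - P t * G * P t + H) t)
    (hG : G.PosSemidef) (hH : H.PosSemidef) (h0 : (P 0).PosDef)
    (ha : ‖A‖ ≤ a) (hg : ‖G‖ ≤ g) (hh : ‖H‖ ≤ h) (hγ : ‖P 0‖ ≤ γ)
    {t : ℝ} (ht : t ∈ Ico 0 T) : ‖P t‖ ≤ (γ + 1) * Real.exp ((2 * a + g + h + 1) * T) := by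
  have ha0 : 0 ≤ a := (norm_nonneg _).trans ha
  have hg0 : 0 ≤ g := (norm_nonneg _).trans hg
  have hh0 : 0 ≤ h := (norm_nonneg _).trans hh
  have hγ0 : 0 ≤ γ := (norm_nonneg _).trans hγ
  -- The upper barrier needs a rate above `2 * a + h`, the lower one a rate above `2 * a + g`; this
  -- choice exceeds both.
  set K := 2 * a + g + h + 1 with hK
  have hK0 : 0 < K := by positivity
  have hsymm : ∀ t ∈ Icc 0 T, (P t).IsHermitian := fun t ht =>
    isHermitian_of_riccati hT hP hd hG.1 hH.1 h0.1 ht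
  have hone : ∀ c : ℝ, (c • (1 : Matrix (Fin n) (Fin n) ℝ)).IsHermitian := fun c => by
    simp [IsHermitian]
  have hvv : ∀ v : Fin n → ℝ, v ≠ 0 → 0 < v ⬝ᵥ v := fun v hv => by
    simpa using dotProduct_star_self_pos_iff.2 hv
  have hqA : ∀ v : Fin n → ℝ, |v ⬝ᵥ A *ᵥ v| ≤ a * (v ⬝ᵥ v) := fun v =>
    (abs_dotProduct_mulVec_le A v).trans
      (mul_le_mul_of_nonneg_right ha (by simpa using dotProduct_star_self_nonneg v))
  have hqG : ∀ v : Fin n → ℝ, |v ⬝ᵥ G *ᵥ v| ≤ g * (v ⬝ᵥ v) := fun v =>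
    (abs_dotProduct_mulVec_le G v).trans
      (mul_le_mul_of_nonneg_right hg (by simpa using dotProduct_star_self_nonneg v))
  have hqH : ∀ v : Fin n → ℝ, |v ⬝ᵥ H *ᵥ v| ≤ h * (v ⬝ᵥ v) := fun v =>
    (abs_dotProduct_mulVec_le H v).trans
      (mul_le_mul_of_nonneg_right hh (by simpa using dotProduct_star_self_nonneg v))
  have hupper : ((((γ + 1) * Real.exp (K * t)) • (1 : Matrix (Fin n) (Fin n) ℝ)) - P t).PosDef := by
    have hb : ∀ s, HasDerivAt (fun s => (γ + 1) * Real.exp (K * s))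
        (K * ((γ + 1) * Real.exp (K * s))) s := fun s => by
      have hl : HasDerivAt (fun s => K * s) K s := by simpa using (hasDerivAt_id s).const_mul K
      exact (hl.exp.const_mul (γ + 1)).congr_deriv (by ring)
    refine PosDef.of_hasDerivAt
      (W := fun s => ((γ + 1) * Real.exp (K * s)) • (1 : Matrix (Fin n) (Fin n) ℝ) - P s)
      (W' := fun s => (K * ((γ + 1) * Real.exp (K * s))) • (1 : Matrix (Fin n) (Fin n) ℝ)
        - (A * P s + P s * Aᵀ - P s * G * P s + H))
      (ContinuousOn.sub (by fun_prop) hP)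
      (fun s hs => (hone _).sub (hsymm s hs)) ?_
      (fun s hs => ((hb s).smul_const _).sub (hd s hs)) ?_ ht
    · refine .of_dotProduct_mulVec_pos ((hone _).sub h0.1) fun v hv => ?_
      have := (le_abs_self _).trans (abs_dotProduct_mulVec_le (P 0) v)
      have := hvv v hv
      simp only [star_trivial, mul_zero, Real.exp_zero, mul_one, sub_mulVec, smul_mulVec, one_mulVec,
        dotProduct_sub, dotProduct_smul, smul_eq_mul]
      nlinarith
    · intro s hs v hv hker
      rw [sub_mulVec, sub_eq_zero, smul_mulVec, one_mulVec] at hker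
      -- A barrier of at least one lets `b * h` absorb `h`; hence `γ + 1`, which also makes the
      -- initial inequality strict.
      have hb1 : 1 ≤ (γ + 1) * Real.exp (K * s) :=
        one_le_mul_of_one_le_of_one_le (by linarith) (Real.one_le_exp (by nlinarith [hs.1]))
      set b := (γ + 1) * Real.exp (K * s)
      rw [sub_mulVec, dotProduct_sub, dotProduct_riccati_mulVec (hsymm s (Ioo_subset_Icc_self hs))
        hker.symm]
      have hpos := hvv v hv
      have hG0 : 0 ≤ v ⬝ᵥ G *ᵥ v := by simpa using hG.dotProduct_mulVec_nonneg v
      have h₁ := (abs_le.1 (hqA v)).2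
      have h₂ := (abs_le.1 (hqH v)).2
      simp only [smul_mulVec, one_mulVec, dotProduct_smul, smul_eq_mul]
      have h₃ : 2 * b * (v ⬝ᵥ A *ᵥ v) ≤ 2 * b * (a * (v ⬝ᵥ v)) := by gcongr
      have h₄ : h * (v ⬝ᵥ v) ≤ b * (h * (v ⬝ᵥ v)) := le_mul_of_one_le_left (by positivity) hb1
      have h₅ : 0 ≤ b ^ 2 * (v ⬝ᵥ G *ᵥ v) := by positivity
      have h₆ : 0 < b * (v ⬝ᵥ v) := by positivity
      have h₇ : 0 ≤ b * (v ⬝ᵥ v) * g := by positivity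
      rw [hK]
      linarith
  -- The shift by `T` keeps the barrier at most one on the whole interval, so that `b ^ 2 ≤ b`
  -- controls the quadratic term.
  have hlower : (P t + Real.exp (K * (t - T)) • (1 : Matrix (Fin n) (Fin n) ℝ)).PosDef := by
    have hb : ∀ s, HasDerivAt (fun s => Real.exp (K * (s - T)))
        (K * Real.exp (K * (s - T))) s := fun s => by
      have hl : HasDerivAt (fun s => K * (s - T)) K s := by
        simpa using ((hasDerivAt_id s).sub_const T).const_mul K
      exact hl.exp.congr_deriv (mul_comm _ _)
    refine PosDef.of_hasDerivAt
      (W := fun s => P s + Real.exp (K * (s - T)) • (1 : Matrix (Fin n) (Fin n) ℝ))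
      (W' := fun s => (A * P s + P s * Aᵀ - P s * G * P s + H)
        + (K * Real.exp (K * (s - T))) • (1 : Matrix (Fin n) (Fin n) ℝ))
      (ContinuousOn.add hP (by fun_prop))
      (fun s hs => (hsymm s hs).add (hone _))
      (h0.add_posSemidef (PosSemidef.one.smul (Real.exp_pos _).le))
      (fun s hs => (hd s hs).add ((hb s).smul_const _)) ?_ ht
    intro s hs v hv hker
    rw [add_mulVec, smul_mulVec, one_mulVec, add_eq_zero_iff_eq_neg, ← neg_smul] at hker
    have hb0 : 0 < Real.exp (K * (s - T)) := Real.exp_pos _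
    have hb1 : Real.exp (K * (s - T)) ≤ 1 :=
      Real.exp_le_one_iff.2 (mul_nonpos_of_nonneg_of_nonpos hK0.le (by linarith [hs.2]))
    set b := Real.exp (K * (s - T))
    rw [add_mulVec, dotProduct_add, dotProduct_riccati_mulVec (hsymm s (Ioo_subset_Icc_self hs))
      hker]
    have hpos := hvv v hv
    have hH0 : 0 ≤ v ⬝ᵥ H *ᵥ v := by simpa using hH.dotProduct_mulVec_nonneg v
    have h₁ := (abs_le.1 (hqA v)).2
    have h₂ := (abs_le.1 (hqG v)).2
    simp only [smul_mulVec, one_mulVec, dotProduct_smul, smul_eq_mul]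
    have h₃ : b * (v ⬝ᵥ A *ᵥ v) ≤ b * (a * (v ⬝ᵥ v)) := by gcongr
    have h₄ : b ^ 2 * (v ⬝ᵥ G *ᵥ v) ≤ b * (g * (v ⬝ᵥ v)) := by
      calc _ ≤ b ^ 2 * (g * (v ⬝ᵥ v)) := by gcongr
        _ ≤ _ := mul_le_mul_of_nonneg_right (by nlinarith) (by positivity)
    have h₆ : 0 < b * (v ⬝ᵥ v) := by positivity
    have h₇ : 0 ≤ b * (v ⬝ᵥ v) * h := by positivity
    rw [hK, neg_sq]
    linarith
  refine (hsymm t (Ico_subset_Icc_self ht)).norm_le_of_abs_dotProduct_mulVec_le (by positivity)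
    fun v => ?_
  have hv0 : 0 ≤ v ⬝ᵥ v := by simpa using dotProduct_star_self_nonneg v
  have h₁ := hupper.posSemidef.dotProduct_mulVec_nonneg v
  have h₂ := hlower.posSemidef.dotProduct_mulVec_nonneg v
  simp only [star_trivial, sub_mulVec, add_mulVec, smul_mulVec, one_mulVec, dotProduct_sub,
    dotProduct_add, dotProduct_smul, smul_eq_mul] at h₁ h₂
  have hE : 1 ≤ (γ + 1) * Real.exp (K * T) :=
    one_le_mul_of_one_le_of_one_le (by linarith) (Real.one_le_exp (by positivity))
  have hE₁ : (γ + 1) * Real.exp (K * t) ≤ (γ + 1) * Real.exp (K * T) := by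
    gcongr; exact ht.2.le
  have hE₂ : Real.exp (K * (t - T)) ≤ 1 :=
    Real.exp_le_one_iff.2 (mul_nonpos_of_nonneg_of_nonpos hK0.le (by linarith [ht.2]))
  rw [abs_le]
  constructor <;> nlinarith

end Matrix

/-! ### Integral and matrix norm estimates -/

/-- Hölder's inequality on `(0, T)`: the `L¹` norm is controlled by the `L²` norm. -/
theorem integral_norm_le_of_eLpNorm_two_le {E : Type*} [NormedAddCommGroup E] {y : ℝ → E}
    {T M : ℝ} (hT : 0 ≤ T) (hM : 0 ≤ M) (hy : MemLp y 2 (volume.restrict (Ioo 0 T)))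
    (hyM : eLpNorm y 2 (volume.restrict (Ioo 0 T)) ≤ ENNReal.ofReal M) :
    ∫ t in Ioo 0 T, ‖y t‖ ≤ M * √T := by
  have h := eLpNorm_le_eLpNorm_mul_rpow_measure_univ (p := 1) (q := 2) (by norm_num)
    hy.aestronglyMeasurable
  rw [integral_norm_eq_lintegral_enorm hy.aestronglyMeasurable, ← eLpNorm_one_eq_lintegral_enorm]
  refine ENNReal.toReal_le_of_le_ofReal (by positivity) (h.trans ?_)
  rw [ENNReal.ofReal_mul hM]
  refine mul_le_mul' hyM ?_
  rw [Measure.restrict_apply_univ, Real.volume_Ioo, sub_zero,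
    ENNReal.ofReal_rpow_of_nonneg hT (by norm_num), Real.sqrt_eq_rpow]
  norm_num

namespace Matrix

/-- The action of a matrix on Euclidean vectors is bounded by the spectral norm. -/
theorem norm_toEuclideanLin_le {k l : ℕ} {A : Matrix (Fin k) (Fin l) ℝ}
    {x : EuclideanSpace ℝ (Fin l)} {a b : ℝ} (hA : ‖A‖ ≤ a) (hx : ‖x‖ ≤ b) :
    ‖A.toEuclideanLin x‖ ≤ a * b :=
  (l2_opNorm_mulVec A x).trans
    (mul_le_mul hA hx (norm_nonneg _) ((norm_nonneg _).trans hA))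

/-- Norm bound for a product of rectangular matrices. -/
theorem l2_opNorm_mul_le_of_le {k l m : ℕ} {A : Matrix (Fin k) (Fin l) ℝ}
    {B : Matrix (Fin l) (Fin m) ℝ} {a b : ℝ} (hA : ‖A‖ ≤ a) (hB : ‖B‖ ≤ b) :
    ‖A * B‖ ≤ a * b :=
  (l2_opNorm_mul A B).trans (mul_le_mul hA hB (norm_nonneg _) ((norm_nonneg _).trans hA))

/-- Inversion is Lipschitz on matrices with bounded inverse. -/
theorem norm_inv_sub_inv_le {r : ℕ} {Q₁ Q₂ : Matrix (Fin r) (Fin r) ℝ} {M : ℝ}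
    (h₁ : IsUnit Q₁.det) (h₂ : IsUnit Q₂.det) (hM₁ : ‖Q₁⁻¹‖ ≤ M) (hM₂ : ‖Q₂⁻¹‖ ≤ M) :
    ‖Q₁⁻¹ - Q₂⁻¹‖ ≤ M * ‖Q₁ - Q₂‖ * M := by
  have h : Q₁⁻¹ - Q₂⁻¹ = Q₁⁻¹ * (Q₂ - Q₁) * Q₂⁻¹ := by
    rw [mul_sub, sub_mul, nonsing_inv_mul _ h₁, one_mul, mul_assoc, mul_nonsing_inv _ h₂, mul_one]
  rw [h, norm_sub_rev Q₁]
  exact norm_mul_le_of_le (norm_mul_le_of_le hM₁ le_rfl) hM₂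

end Matrix

/-! ### Bounds and Lipschitz estimates for covariance, gain and filter -/

namespace SystemData

variable {n m r : ℕ} {S S₁ S₂ : SystemData n m r} {B : Matrix (Fin n) (Fin m) ℝ}
  {C : Matrix (Fin r) (Fin n) ℝ} {T M p : ℝ} {x₀ : EuclideanSpace ℝ (Fin n)}
  {y : ℝ → EuclideanSpace ℝ (Fin r)} {P P₁ P₂ : ℝ → Matrix (Fin n) (Fin n) ℝ}
  {x x₁ x₂ : ℝ → EuclideanSpace ℝ (Fin n)}

/-- Regrouping exhibits the coefficients `G = Cᵀ * S.Q⁻¹ * C` and `H = B * S.R * Bᵀ` of the general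
Riccati estimates. -/
theorem IsRiccatiSolution.hasDerivAt_of_assoc (hP : S.IsRiccatiSolution B C T P) :
    ∀ t ∈ Ioo 0 T, HasDerivAt P
      (S.A * P t + P t * S.Aᵀ - P t * (Cᵀ * S.Q⁻¹ * C) * P t + B * S.R * Bᵀ) t := fun t ht =>
  (hP.hasDerivAt t ht).congr_deriv (by simp only [Matrix.mul_assoc])

theorem norm_observation_le (hC : ‖C‖ ≤ M) (hSM : S.BoundedBy M) :
    ‖Cᵀ * S.Q⁻¹ * C‖ ≤ M * M * M :=
  Matrix.l2_opNorm_mul_le_of_le (Matrix.l2_opNorm_mul_le_of_le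
    ((Matrix.l2_opNorm_transpose C).trans_le hC) hSM.norm_Q_inv_le) hC

/-- Uniform bound for the error covariance in terms of bounds on the data. -/
theorem IsRiccatiSolution.norm_le (hP : S.IsRiccatiSolution B C T P) (hT : 0 < T)
    (hS : S.IsAdmissible) (hSM : S.BoundedBy M) (hB : ‖B‖ ≤ M) (hC : ‖C‖ ≤ M) :
    ∀ t ∈ Ioo 0 T,
      ‖P t‖ ≤ (M + 1) * Real.exp ((2 * M + M * M * M + M * M * M + 1) * T) := by
  intro t ht
  have hBR : ‖B * S.R * Bᵀ‖ ≤ M * M * M :=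
    Matrix.l2_opNorm_mul_le_of_le (Matrix.l2_opNorm_mul_le_of_le hB hSM.norm_R_le)
      ((Matrix.l2_opNorm_transpose B).trans_le hB)
  refine Matrix.norm_riccati_le hT hP.continuousOn hP.hasDerivAt_of_assoc ?_ ?_
    (hP.initial ▸ hS.posDef_Γ) hSM.norm_A_le (norm_observation_le hC hSM) hBR
    (hP.initial ▸ hSM.norm_Γ_le) (Ioo_subset_Ico_self ht)
  · simpa using hS.posDef_Q.inv.posSemidef.conjTranspose_mul_mul_same C
  · simpa using hS.posDef_R.posSemidef.mul_mul_conjTranspose_same B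

theorem norm_A_sub_le : ‖S₁.A - S₂.A‖ ≤ (S₁ - S₂).norm₁ := by
  change _ ≤ ‖S₁.A - S₂.A‖ + ‖S₁.Γ - S₂.Γ‖ + ‖S₁.R - S₂.R‖ + ‖S₁.Q - S₂.Q‖
  linarith [norm_nonneg (S₁.Γ - S₂.Γ), norm_nonneg (S₁.R - S₂.R), norm_nonneg (S₁.Q - S₂.Q)]

theorem norm_Γ_sub_le : ‖S₁.Γ - S₂.Γ‖ ≤ (S₁ - S₂).norm₁ := by
  change _ ≤ ‖S₁.A - S₂.A‖ + ‖S₁.Γ - S₂.Γ‖ + ‖S₁.R - S₂.R‖ + ‖S₁.Q - S₂.Q‖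
  linarith [norm_nonneg (S₁.A - S₂.A), norm_nonneg (S₁.R - S₂.R), norm_nonneg (S₁.Q - S₂.Q)]

theorem norm_R_sub_le : ‖S₁.R - S₂.R‖ ≤ (S₁ - S₂).norm₁ := by
  change _ ≤ ‖S₁.A - S₂.A‖ + ‖S₁.Γ - S₂.Γ‖ + ‖S₁.R - S₂.R‖ + ‖S₁.Q - S₂.Q‖
  linarith [norm_nonneg (S₁.A - S₂.A), norm_nonneg (S₁.Γ - S₂.Γ), norm_nonneg (S₁.Q - S₂.Q)]

theorem norm_Q_sub_le : ‖S₁.Q - S₂.Q‖ ≤ (S₁ - S₂).norm₁ := by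
  change _ ≤ ‖S₁.A - S₂.A‖ + ‖S₁.Γ - S₂.Γ‖ + ‖S₁.R - S₂.R‖ + ‖S₁.Q - S₂.Q‖
  linarith [norm_nonneg (S₁.A - S₂.A), norm_nonneg (S₁.Γ - S₂.Γ), norm_nonneg (S₁.R - S₂.R)]

theorem norm_Q_inv_sub_le (hS₁ : S₁.IsAdmissible) (hS₂ : S₂.IsAdmissible)
    (hM₁ : S₁.BoundedBy M) (hM₂ : S₂.BoundedBy M) :
    ‖S₁.Q⁻¹ - S₂.Q⁻¹‖ ≤ M * (S₁ - S₂).norm₁ * M := by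
  have hM : 0 ≤ M := (norm_nonneg _).trans hM₁.norm_A_le
  refine (Matrix.norm_inv_sub_inv_le hS₁.posDef_Q.det_pos.ne'.isUnit
    hS₂.posDef_Q.det_pos.ne'.isUnit hM₁.norm_Q_inv_le hM₂.norm_Q_inv_le).trans ?_
  gcongr
  exact norm_Q_sub_le

/-- The error covariance depends Lipschitz continuously on the data. -/
theorem IsRiccatiSolution.norm_sub_le (hP₁ : S₁.IsRiccatiSolution B C T P₁)
    (hP₂ : S₂.IsRiccatiSolution B C T P₂) (hT : 0 < T)
    (hS₁ : S₁.IsAdmissible) (hS₂ : S₂.IsAdmissible)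
    (hM₁ : S₁.BoundedBy M) (hM₂ : S₂.BoundedBy M) (hB : ‖B‖ ≤ M) (hC : ‖C‖ ≤ M)
    (hp₁ : ∀ t ∈ Ioo 0 T, ‖P₁ t‖ ≤ p) (hp₂ : ∀ t ∈ Ioo 0 T, ‖P₂ t‖ ≤ p) :
    ∀ t ∈ Ioo 0 T, ‖P₁ t - P₂ t‖ ≤ Real.exp ((2 * M + 2 * (p * (M * M * M))) * T) *
      (1 + T * (2 * p + p * (M ^ 4) * p + M ^ 2)) * (S₁ - S₂).norm₁ := by
  intro t ht
  have hM : 0 ≤ M := (norm_nonneg _).trans hB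
  have hp : 0 ≤ p := (norm_nonneg _).trans (hp₁ t ht)
  have hCt : ‖Cᵀ‖ ≤ M := (Matrix.l2_opNorm_transpose C).trans_le hC
  have hBt : ‖Bᵀ‖ ≤ M := (Matrix.l2_opNorm_transpose B).trans_le hB
  have hG : ‖Cᵀ * S₁.Q⁻¹ * C - Cᵀ * S₂.Q⁻¹ * C‖ ≤ M * (M * (S₁ - S₂).norm₁ * M) * M := by
    rw [← Matrix.sub_mul, ← Matrix.mul_sub]
    exact Matrix.l2_opNorm_mul_le_of_le (Matrix.l2_opNorm_mul_le_of_le hCt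
      (norm_Q_inv_sub_le hS₁ hS₂ hM₁ hM₂)) hC
  have hH : ‖B * S₁.R * Bᵀ - B * S₂.R * Bᵀ‖ ≤ M * (S₁ - S₂).norm₁ * M := by
    rw [← Matrix.sub_mul, ← Matrix.mul_sub]
    exact Matrix.l2_opNorm_mul_le_of_le (Matrix.l2_opNorm_mul_le_of_le hB norm_R_sub_le) hBt
  have hΓ : ‖P₁ 0 - P₂ 0‖ ≤ (S₁ - S₂).norm₁ := by
    rw [hP₁.initial, hP₂.initial]; exact norm_Γ_sub_le
  have hA : ‖S₁.A - S₂.A‖ ≤ (S₁ - S₂).norm₁ := norm_A_sub_le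
  refine (Matrix.norm_riccati_sub_le hT hP₁.continuousOn hP₂.continuousOn hP₁.hasDerivAt_of_assoc
    hP₂.hasDerivAt_of_assoc hM₂.norm_A_le (norm_observation_le hC hM₁) (norm_observation_le hC hM₂)
    hp₁ hp₂ (Ioo_subset_Icc_self ht)).trans ?_
  calc _ ≤ Real.exp ((2 * M + 2 * (p * (M * M * M))) * T) *
      ((S₁ - S₂).norm₁ + T * (2 * ((S₁ - S₂).norm₁ * p)
        + p * (M * (M * (S₁ - S₂).norm₁ * M) * M) * p + M * (S₁ - S₂).norm₁ * M)) := by gcongr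
    _ = _ := by ring

theorem norm_gain_le (hC : ‖C‖ ≤ M) (hSM : S.BoundedBy M) {t : ℝ} (hp : ‖P t‖ ≤ p) :
    ‖P t * Cᵀ * S.Q⁻¹‖ ≤ p * M * M :=
  Matrix.l2_opNorm_mul_le_of_le (Matrix.l2_opNorm_mul_le_of_le hp
    ((Matrix.l2_opNorm_transpose C).trans_le hC)) hSM.norm_Q_inv_le

/-- Uniform bound for the filter trajectory in terms of bounds on the data. -/
theorem IsFilterSolution.norm_le (hx : S.IsFilterSolution C T x₀ y P x) (hp0 : 0 ≤ p)
    (hp : ∀ t ∈ Ioo 0 T, ‖P t‖ ≤ p) (hSM : S.BoundedBy M) (hC : ‖C‖ ≤ M) (hx₀ : ‖x₀‖ ≤ M)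
    (hy : IntegrableOn y (Ioo 0 T)) {Y : ℝ} (hY : ∫ t in Ioo 0 T, ‖y t‖ ≤ Y)
    {t : ℝ} (ht : t ∈ Icc 0 T) :
    ‖x t‖ ≤ Real.exp ((M + p * M * M * M) * T) * (M + p * M * M * Y) := by
  have hM : 0 ≤ M := (norm_nonneg _).trans hC
  have h := hx.absolutelyContinuous.norm_le_exp_mul (K := M + p * M * M * M)
    (b := fun t => p * M * M * ‖y t‖) (by positivity) hx.hasDerivAt (hy.norm.const_mul _)
    (fun t => by positivity)
    (by
      filter_upwards [ae_restrict_mem measurableSet_Ioo] with s hs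
      have h₁ : ‖y s - C.toEuclideanLin (x s)‖ ≤ ‖y s‖ + M * ‖x s‖ :=
        norm_sub_le_of_le le_rfl (Matrix.norm_toEuclideanLin_le hC le_rfl)
      refine (norm_add_le_of_le (Matrix.norm_toEuclideanLin_le hSM.norm_A_le le_rfl)
        (Matrix.norm_toEuclideanLin_le (norm_gain_le hC hSM (hp s hs)) h₁)).trans_eq ?_
      ring) ht
  rw [hx.initial, integral_const_mul] at h
  exact h.trans (by gcongr)

/-- The filter trajectory depends Lipschitz continuously on the data. -/
theorem IsFilterSolution.norm_sub_le (hx₁ : S₁.IsFilterSolution C T x₀ y P₁ x₁)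
    (hx₂ : S₂.IsFilterSolution C T x₀ y P₂ x₂)
    (hS₁ : S₁.IsAdmissible) (hS₂ : S₂.IsAdmissible)
    (hM₁ : S₁.BoundedBy M) (hM₂ : S₂.BoundedBy M) (hC : ‖C‖ ≤ M) (hp0 : 0 ≤ p)
    (hp₂ : ∀ t ∈ Ioo 0 T, ‖P₂ t‖ ≤ p) {d X Y : ℝ} (hd : 0 ≤ d)
    (hd₁₂ : ∀ t ∈ Ioo 0 T, ‖P₁ t - P₂ t‖ ≤ d * (S₁ - S₂).norm₁) (hX0 : 0 ≤ X)
    (hX : ∀ t ∈ Icc 0 T, ‖x₁ t‖ ≤ X)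
    (hy : IntegrableOn y (Ioo 0 T)) (hY : ∫ t in Ioo 0 T, ‖y t‖ ≤ Y)
    {t : ℝ} (ht : t ∈ Icc 0 T) :
    ‖x₁ t - x₂ t‖ ≤ Real.exp ((M + p * M * M * M) * T) *
      (X * T + (d * M * M + p * M * M * M) * (Y + M * X * T)) * (S₁ - S₂).norm₁ := by
  have hM : 0 ≤ M := (norm_nonneg _).trans hC
  have hCt : ‖Cᵀ‖ ≤ M := (Matrix.l2_opNorm_transpose C).trans_le hC
  set N := (S₁ - S₂).norm₁ with hN
  have hN0 : 0 ≤ N := (norm_nonneg _).trans norm_A_sub_le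
  set l := d * M * M + p * M * M * M with hl
  have hl0 : 0 ≤ l := by positivity
  have hgain : ∀ s ∈ Ioo 0 T, ‖P₁ s * Cᵀ * S₁.Q⁻¹ - P₂ s * Cᵀ * S₂.Q⁻¹‖ ≤ l * N := by
    intro s hs
    have hsplit : P₁ s * Cᵀ * S₁.Q⁻¹ - P₂ s * Cᵀ * S₂.Q⁻¹
        = (P₁ s - P₂ s) * Cᵀ * S₁.Q⁻¹ + P₂ s * Cᵀ * (S₁.Q⁻¹ - S₂.Q⁻¹) := by
      rw [Matrix.sub_mul, Matrix.sub_mul, Matrix.mul_sub]; abel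
    rw [hsplit]
    refine (norm_add_le_of_le (Matrix.l2_opNorm_mul_le_of_le
      (Matrix.l2_opNorm_mul_le_of_le (hd₁₂ s hs) hCt) hM₁.norm_Q_inv_le)
      (Matrix.l2_opNorm_mul_le_of_le (Matrix.l2_opNorm_mul_le_of_le (hp₂ s hs) hCt)
        (norm_Q_inv_sub_le hS₁ hS₂ hM₁ hM₂))).trans_eq ?_
    rw [hl]; ring
  have hconst : IntegrableOn (fun _ : ℝ => N * X + l * N * (M * X)) (Ioo 0 T) :=
    integrableOn_const (by simp)
  have hyint : IntegrableOn (fun s => l * N * ‖y s‖) (Ioo 0 T) := hy.norm.const_mul _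
  have h := (hx₁.absolutelyContinuous.fun_sub hx₂.absolutelyContinuous).norm_le_exp_mul
    (K := M + p * M * M * M)
    (b := fun s => (N * X + l * N * (M * X)) + l * N * ‖y s‖) (by positivity)
    (by filter_upwards [hx₁.hasDerivAt, hx₂.hasDerivAt] with s h₁ h₂ using h₁.fun_sub h₂)
    (hconst.add hyint) (fun s => by positivity)
    (by
      filter_upwards [ae_restrict_mem measurableSet_Ioo] with s hs
      have hXs := hX s (Ioo_subset_Icc_self hs)
      -- The data differences all act on `x₁`, so only that trajectory needs an a priori bound; the
      -- homogeneous part carries the second tuple alone, whence the rate `M + p * M * M * M`.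
      have hsplit : (S₁.A.toEuclideanLin (x₁ s)
            + (P₁ s * Cᵀ * S₁.Q⁻¹).toEuclideanLin (y s - C.toEuclideanLin (x₁ s)))
          - (S₂.A.toEuclideanLin (x₂ s)
            + (P₂ s * Cᵀ * S₂.Q⁻¹).toEuclideanLin (y s - C.toEuclideanLin (x₂ s)))
          = (S₁.A - S₂.A).toEuclideanLin (x₁ s) + S₂.A.toEuclideanLin (x₁ s - x₂ s)
            + (P₁ s * Cᵀ * S₁.Q⁻¹ - P₂ s * Cᵀ * S₂.Q⁻¹).toEuclideanLin
                (y s - C.toEuclideanLin (x₁ s))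
            - (P₂ s * Cᵀ * S₂.Q⁻¹).toEuclideanLin (C.toEuclideanLin (x₁ s - x₂ s)) := by
        simp only [map_sub, LinearMap.sub_apply]; abel
      rw [hsplit]
      have hinn : ‖y s - C.toEuclideanLin (x₁ s)‖ ≤ ‖y s‖ + M * X :=
        norm_sub_le_of_le le_rfl (Matrix.norm_toEuclideanLin_le hC hXs)
      refine (norm_sub_le_of_le (norm_add_le_of_le (norm_add_le_of_le
        (Matrix.norm_toEuclideanLin_le norm_A_sub_le hXs)
        (Matrix.norm_toEuclideanLin_le hM₂.norm_A_le le_rfl))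
        (Matrix.norm_toEuclideanLin_le (hgain s hs) hinn))
        (Matrix.norm_toEuclideanLin_le (norm_gain_le hC hM₂ (hp₂ s hs))
          (Matrix.norm_toEuclideanLin_le hC le_rfl))).trans_eq ?_
      rw [← hN]; ring) ht
  have hT : 0 ≤ T := ht.1.trans ht.2
  rw [hx₁.initial, hx₂.initial, sub_self, norm_zero, zero_add, integral_add hconst hyint,
    integral_const_mul, setIntegral_const, Real.volume_real_Ioo_of_le hT, sub_zero,
    smul_eq_mul] at h
  calc _ ≤ _ := h
    _ ≤ Real.exp ((M + p * M * M * M) * T) *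
        (T * (N * X + l * N * (M * X)) + l * N * Y) := by gcongr
    _ = _ := by ring

end SystemData

/-! ### The uniform constant -/

theorem mainTheorem7 (n m r : ℕ) (T : ℝ) (hT : 0 < T) (M : ℝ) :
    ∃ c : ℝ, 0 < c ∧
      ∀ (B : Matrix (Fin n) (Fin m) ℝ) (C : Matrix (Fin r) (Fin n) ℝ)
        (x₀ : EuclideanSpace ℝ (Fin n)) (y : ℝ → EuclideanSpace ℝ (Fin r))
        (S_star S_bar : SystemData n m r)
        (P_star P_bar : ℝ → Matrix (Fin n) (Fin n) ℝ)
        (x_star x_bar : ℝ → EuclideanSpace ℝ (Fin n)),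
        ‖B‖ ≤ M → ‖C‖ ≤ M → ‖x₀‖ ≤ M →
        MemLp y 2 (volume.restrict (Ioo 0 T)) →
        eLpNorm y 2 (volume.restrict (Ioo 0 T)) ≤ ENNReal.ofReal M →
        S_star.IsAdmissible → S_bar.IsAdmissible →
        S_star.BoundedBy M → S_bar.BoundedBy M →
        S_star.IsRiccatiSolution B C T P_star →
        S_bar.IsRiccatiSolution B C T P_bar →
        S_star.IsFilterSolution C T x₀ y P_star x_star →
        S_bar.IsFilterSolution C T x₀ y P_bar x_bar →
        ∀ t ∈ Icc 0 T, ‖x_star t - x_bar t‖ ≤ c * (S_star - S_bar).norm₁ := by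
  rcases lt_or_ge M 0 with hM | hM
  · exact ⟨1, one_pos, fun B _ _ _ _ _ _ _ _ _ hB => absurd ((norm_nonneg B).trans hB) hM.not_ge⟩
  set p := (M + 1) * Real.exp ((2 * M + M * M * M + M * M * M + 1) * T) with hp
  have hp0 : 0 ≤ p := by positivity
  set d := Real.exp ((2 * M + 2 * (p * (M * M * M))) * T) *
    (1 + T * (2 * p + p * (M ^ 4) * p + M ^ 2)) with hd
  have hd0 : 0 ≤ d := by positivity
  set Y := M * √T with hY
  have hY0 : 0 ≤ Y := by positivity
  set X := Real.exp ((M + p * M * M * M) * T) * (M + p * M * M * Y) with hX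
  have hX0 : 0 ≤ X := by positivity
  set c := Real.exp ((M + p * M * M * M) * T) *
    (X * T + (d * M * M + p * M * M * M) * (Y + M * X * T)) with hc
  have hc0 : 0 ≤ c := by positivity
  -- For `M = 0` the constant `c` vanishes; adding one makes it positive.
  refine ⟨c + 1, by positivity, ?_⟩
  intro B C x₀ y S₁ S₂ P₁ P₂ x₁ x₂ hB hC hx₀ hy hyM hS₁ hS₂ hM₁ hM₂ hP₁ hP₂ hx₁ hx₂ t ht
  have hYy : ∫ s in Ioo 0 T, ‖y s‖ ≤ Y := integral_norm_le_of_eLpNorm_two_le hT.le hM hy hyM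
  have hyint : IntegrableOn y (Ioo 0 T) := hy.integrable (by norm_num)
  have hp₁ := hP₁.norm_le hT hS₁ hM₁ hB hC
  have hp₂ := hP₂.norm_le hT hS₂ hM₂ hB hC
  have hN : 0 ≤ (S₁ - S₂).norm₁ := (norm_nonneg _).trans SystemData.norm_A_sub_le
  have h := hx₁.norm_sub_le hx₂ hS₁ hS₂ hM₁ hM₂ hC hp0 hp₂ hd0
    (hP₁.norm_sub_le hP₂ hT hS₁ hS₂ hM₁ hM₂ hB hC hp₁ hp₂) hX0
    (fun s hs => hx₁.norm_le hp0 hp₁ hM₁ hC hx₀ hyint hYy hs) hyint hYy ht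
  exact h.trans (mul_le_mul_of_nonneg_right (by linarith) hN)
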